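/- Let $m\ge 0$, let $\varepsilon\in\mathbb C$ with $2\varepsilon\notin\mathbb Z$ (i.e. the dimension $d=d_{\rm int}-2\varepsilon$ is not an integer), and let $s\in\{\varepsilon,-\varepsilon\}$. For a polynomial $G$ on $\mathbb C^m$ let $X_G=\mathbb C^m\setminus\{G=0\}$, let $\Omega^p(X_G)$ be the space of algebraic $p$-forms on $X_G$ (coefficients in $\mathbb C[z_1,\dots,z_m][1/G]$), and let $$\nabla=d+s\,\frac{dG}{G}\wedge\;:\;\Omega^p(X_G)\to\Omega^{p+1}(X_G),\qquad H^p(X_G;\nabla)=\frac{\ker(\nabla:\Omega^p\to\Omega^{p+1})}{\operatorname{im}(\nabla:\Omega^{p-1}\to\Omega^p)}$$ be the algebraic twisted de Rham cohomology attached to the multivalued twist $G^{s}$ (with $\Omega^{-1}=0$). Let $G(z)=z^{T}Az+2b^{T}z+c$ with $A$ a symmetric complex $m\times m$ matrix, $b\in\mathbb C^m$, $c\in\mathbb C$ (degenerate cases allowed). Its squared radius is $$r^2=\det\begin{pmatrix}A&b\\ b^{T}&c\end{pmatrix}\Big/\det A\in\mathbb C\cup\{\infty\},\qquad r^2=\infty\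 \text{if}\ \det A=0,$$ so that $G(z)=(z-z_0)^TA(z-z_0)+r^2$ for some $z_0\in\mathbb C^m$ if $\det A\neq0$. Then the top cohomology of the complexified $m$-sphere $\mathcal S^m=X_G$ satisfies $$\dim_{\mathbb C} H^m(\mathcal S^m;\nabla)=\begin{cases}1,&r\neq0,\infty,\\0,&\text{otherwise,}\end{cases}$$ and for $r\ne0,\infty$ it is spanned by the class of $dz_1\wedge\dots\wedge dz_m/G^{\lfloor (m+1)/2\rfloor}$. In particular, for $G=r^2+\sum_i z_i^2$ with $r\in\mathbb C$, $\dim_{\mathbb C} H^m(\mathcal S^m;\nabla)$ is $1$ if $r\ne 0$ and $0$ if $r=0$; and for $r\neq0$ it is spanned by the class of the rotationally symmetric form $$d\Omega^{(m)}=c_{m-1}\,r^{\delta_{m,\mathrm{odd}}}\,\frac{dz_1\wedge\cdots\wedge dz_m}{\bigl(r^2+\sum_i z_i^2\bigr)^{\lfloor\frac{m+1}{2}\rfloor}},\qquad c_{m-1}=(2\varepsilon)^{\lfloor\frac m2\rfloor}\,(-\varepsilon)_{\lfloor\frac{m+1}{2}\rfloor},$$ where $(x)_n=x(x+1)\cdots(x+n-1)$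 and $\delta_{m,\mathrm{odd}}$ is $1$ for odd $m$ and $0$ for even $m$. -/

import Mathlib

open MvPolynomial

noncomputable section

namespace TwistedDeRham

/-- The algebra `ℂ[z₁, …, z_m][1/G]` of regular functions on the affine variety
`ℂ^m \ {G = 0}`. -/
def RegularFunction {m : ℕ} (G : MvPolynomial (Fin m) ℂ) : Type :=
  Localization.Away G

instance {m : ℕ} (G : MvPolynomial (Fin m) ℂ) : CommRing (RegularFunction G) :=
  inferInstanceAs (CommRing (Localization.Away G))

instance {m : ℕ} (G : MvPolynomial (Fin m) ℂ) :
    Algebra (MvPolynomial (Fin m) ℂ) (RegularFunction G) :=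
  inferInstanceAs (Algebra (MvPolynomial (Fin m) ℂ) (Localization.Away G))

instance {m : ℕ} (G : MvPolynomial (Fin m) ℂ) : Algebra ℂ (RegularFunction G) :=
  inferInstanceAs (Algebra ℂ (Localization.Away G))

instance {m : ℕ} (G : MvPolynomial (Fin m) ℂ) :
    IsScalarTower ℂ (MvPolynomial (Fin m) ℂ) (RegularFunction G) :=
  inferInstanceAs (IsScalarTower ℂ (MvPolynomial (Fin m) ℂ) (Localization.Away G))

instance {m : ℕ} (G : MvPolynomial (Fin m) ℂ) : IsLocalization.Away G (RegularFunction G) :=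
  inferInstanceAs (IsLocalization.Away G (Localization.Away G))

/-- The partial derivative `∂/∂z_i` on regular functions of `ℂ^m \ {G = 0}`: the unique
derivation that extends `∂/∂z_i` from polynomials. -/
def partialDeriv {m : ℕ} (G : MvPolynomial (Fin m) ℂ) (i : Fin m) :
    Derivation ℂ (RegularFunction G) (RegularFunction G) :=
  haveI : Algebra.FormallyEtale (MvPolynomial (Fin m) ℂ) (RegularFunction G) :=
    Algebra.FormallyEtale.of_isLocalization (Submonoid.powers G)
  ((LinearMap.liftBaseChange (RegularFunction G)
      (mkDerivation ℂ (Pi.single i (1 : RegularFunction G))).liftKaehlerDifferential) ∘ₗ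
    (KaehlerDifferential.tensorKaehlerEquivOfFormallyEtale ℂ (MvPolynomial (Fin m) ℂ)
      (RegularFunction G)).symm.toLinearMap).compDer
    (KaehlerDifferential.D ℂ (RegularFunction G))

theorem partialDeriv_algebraMap {m : ℕ} (G P : MvPolynomial (Fin m) ℂ) (i : Fin m) :
    partialDeriv G i (algebraMap _ (RegularFunction G) P) =
      algebraMap _ (RegularFunction G) (pderiv i P) := by
  have : Algebra.FormallyEtale (MvPolynomial (Fin m) ℂ) (RegularFunction G) :=
    Algebra.FormallyEtale.of_isLocalization (Submonoid.powers G)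
  have h1 : (KaehlerDifferential.tensorKaehlerEquivOfFormallyEtale ℂ (MvPolynomial (Fin m) ℂ)
      (RegularFunction G)).symm
        (KaehlerDifferential.D ℂ (RegularFunction G) (algebraMap _ (RegularFunction G) P)) =
      TensorProduct.tmul _ 1 (KaehlerDifferential.D ℂ _ P) := by
    rw [LinearEquiv.symm_apply_eq]
    change _ = KaehlerDifferential.mapBaseChange ℂ (MvPolynomial (Fin m) ℂ)
      (RegularFunction G) (TensorProduct.tmul _ 1 (KaehlerDifferential.D ℂ _ P))
    simp
  have h2 : partialDeriv G i (algebraMap _ (RegularFunction G) P) =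
      mkDerivation ℂ (Pi.single i (1 : RegularFunction G)) P := by
    simp [partialDeriv, h1]
  rw [h2]
  have h3 : mkDerivation ℂ (Pi.single i (1 : RegularFunction G)) =
      (Algebra.linearMap (MvPolynomial (Fin m) ℂ) (RegularFunction G)).compDer (pderiv i) := by
    apply MvPolynomial.derivation_ext
    intro j
    by_cases hij : j = i
    · subst hij; simp
    · simp [hij, pderiv_X]
  rw [h3]
  rfl

/-- The derivative `∂_v = ∑ i, v_i ∂/∂z_i` of regular functions along a constant vector `v`. -/
def derivAlong {m : ℕ} (G : MvPolynomial (Fin m) ℂ) :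
    (Fin m → ℂ) →ₗ[ℂ] (RegularFunction G →ₗ[ℂ] RegularFunction G) :=
  ∑ i, (LinearMap.proj i : (Fin m → ℂ) →ₗ[ℂ] ℂ).smulRight
    (partialDeriv G i : RegularFunction G →ₗ[ℂ] RegularFunction G)

/-- Algebraic differential `p`-forms on `ℂ^m \ {G = 0}`, that is, sums
`∑ f_{i₁…i_p} dz_{i₁} ∧ … ∧ dz_{i_p}` with regular coefficients, written as alternating maps on
the constant vector fields (the coefficient `f_{i₁…i_p}` is the value at `(e_{i₁}, …, e_{i_p})`). -/
abbrev Form {m : ℕ} (G : MvPolynomial (Fin m) ℂ) (p : ℕ) : Type :=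
  (Fin m → ℂ) [⋀^Fin p]→ₗ[ℂ] RegularFunction G

/-- The exterior derivative,
`(dφ)(v₀, …, v_p) = ∑ i, (-1)^i ∂_{v_i} (φ(v₀, …, v̂_i, …, v_p))`. -/
def extD {m : ℕ} (G : MvPolynomial (Fin m) ℂ) (p : ℕ) : Form G p →ₗ[ℂ] Form G (p + 1) :=
  AlternatingMap.alternatizeUncurryFinLM ∘ₗ
    (LinearMap.mk₂ ℂ (fun φ v => (derivAlong G v).compAlternatingMap φ)
      (by intros; ext; simp) (by intros; ext; simp) (by intros; ext; simp)
      (by intros; ext; simp))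

/-- The left wedge product with a `1`-form `η`,
`(η ∧ φ)(v₀, …, v_p) = ∑ i, (-1)^i η(v_i) φ(v₀, …, v̂_i, …, v_p)`. -/
def wedgeLeft {m : ℕ} (G : MvPolynomial (Fin m) ℂ) (η : (Fin m → ℂ) →ₗ[ℂ] RegularFunction G)
    (p : ℕ) : Form G p →ₗ[ℂ] Form G (p + 1) :=
  AlternatingMap.alternatizeUncurryFinLM ∘ₗ
    (LinearMap.mk₂ ℂ (fun φ v => η v • φ)
      (by intros; ext; simp) (by intros; ext; simp)
      (by intros; ext; simp [add_mul]) (by intros; ext; simp))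

/-- The `1`-form `d log G = dG / G` on `ℂ^m \ {G = 0}`. -/
def dlog {m : ℕ} (G : MvPolynomial (Fin m) ℂ) : (Fin m → ℂ) →ₗ[ℂ] RegularFunction G :=
  LinearMap.mulLeft ℂ (IsLocalization.Away.invSelf G) ∘ₗ
    (derivAlong G).flip (algebraMap _ (RegularFunction G) G)

/-- The covariant derivative `∇ = d + ω ∧ ·` with `ω = d log (G ^ s) = s dG / G`, attached to
the twist `G ^ s`. -/
def nabla {m : ℕ} (G : MvPolynomial (Fin m) ℂ) (s : ℂ) (p : ℕ) :
    Form G p →ₗ[ℂ] Form G (p + 1) :=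
  extD G p + wedgeLeft G (s • dlog G) p

/-- The forms of degree `p` in the kernel of the covariant derivative. -/
abbrev closedForms {m : ℕ} (G : MvPolynomial (Fin m) ℂ) (s : ℂ) (p : ℕ) :
    Submodule ℂ (Form G p) :=
  LinearMap.ker (nabla G s p)

instance {m : ℕ} (G : MvPolynomial (Fin m) ℂ) (s : ℂ) (p : ℕ) :
    AddCommGroup (closedForms G s p) :=
  Submodule.addCommGroup _

/-- The forms of degree `p` in the image of the covariant derivative. -/
def exactForms {m : ℕ} (G : MvPolynomial (Fin m) ℂ) (s : ℂ) :
    (p : ℕ) → Submodule ℂ (Form G p)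
  | 0 => ⊥
  | p + 1 => LinearMap.range (nabla G s p)

/-- The twisted de Rham cohomology `H^p(ℂ^m \ {G = 0}; ∇) = ker ∇ / im ∇`. -/
abbrev Cohomology {m : ℕ} (G : MvPolynomial (Fin m) ℂ) (s : ℂ) (p : ℕ) : Type :=
  closedForms G s p ⧸ (exactForms G s p).submoduleOf (closedForms G s p)

/-- The class of a closed form in twisted cohomology. -/
def cohomologyClass {m : ℕ} (G : MvPolynomial (Fin m) ℂ) (s : ℂ) (p : ℕ) (φ : Form G p)
    (hφ : nabla G s p φ = 0) : Cohomology G s p :=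
  Submodule.Quotient.mk ⟨φ, LinearMap.mem_ker.mpr hφ⟩

/-- The holomorphic volume form `dz₁ ∧ … ∧ dz_m`. -/
def volumeForm {m : ℕ} (G : MvPolynomial (Fin m) ℂ) : Form G m :=
  (Algebra.linearMap ℂ (RegularFunction G)).compAlternatingMap
    (Matrix.detRowAlternating : (Fin m → ℂ) [⋀^Fin m]→ₗ[ℂ] ℂ)

/-- The top form `dz₁ ∧ … ∧ dz_m / G ^ ⌊(m + 1) / 2⌋`. -/
def sphereForm {m : ℕ} (G : MvPolynomial (Fin m) ℂ) : Form G m :=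
  (IsLocalization.Away.invSelf G ^ ((m + 1) / 2) : RegularFunction G) • volumeForm G

/-- The polynomial `G(z) = zᵀ A z + 2 bᵀ z + c`. -/
def quadric {m : ℕ} (A : Matrix (Fin m) (Fin m) ℂ) (b : Fin m → ℂ) (c : ℂ) :
    MvPolynomial (Fin m) ℂ :=
  (∑ i, ∑ j, C (A i j) * X i * X j) + C 2 * (∑ i, C (b i) * X i) + C c

/-- The symmetric matrix `[[A, b], [bᵀ, c]]` of the quadric `zᵀ A z + 2 bᵀ z + c`. -/
def borderedMatrix {m : ℕ} (A : Matrix (Fin m) (Fin m) ℂ) (b : Fin m → ℂ) (c : ℂ) :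
    Matrix (Fin m ⊕ Unit) (Fin m ⊕ Unit) ℂ :=
  Matrix.fromBlocks A (Matrix.of fun i _ => b i) (Matrix.of fun _ j => b j)
    (Matrix.of fun _ _ => c)

/-- The squared radius `r² = det [[A, b], [bᵀ, c]] / det A` of the quadric
`G(z) = zᵀ A z + 2 bᵀ z + c`, a point of `ℂ ∪ {∞}`, equal to `∞` when `det A = 0`.
For `det A ≠ 0`, completing the square gives `G = (z - z₀)ᵀ A (z - z₀) + r²`. -/
def radiusSq {m : ℕ} (A : Matrix (Fin m) (Fin m) ℂ) (b : Fin m → ℂ) (c : ℂ) : OnePoint ℂ :=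
  if A.det = 0 then OnePoint.infty
  else (((borderedMatrix A b c).det / A.det : ℂ) : OnePoint ℂ)

/-- The round quadric `G(z) = r² + z₁² + … + z_m²`. -/
def roundQuadric (m : ℕ) (r : ℂ) : MvPolynomial (Fin m) ℂ :=
  C (r ^ 2) + ∑ i, X i ^ 2

/-- The constant `c_{m-1} = (2ε)^⌊m/2⌋ (-ε)_{⌊(m+1)/2⌋}`, where `(x)_n` is the rising
factorial. -/
def sphereConstant (m : ℕ) (ε : ℂ) : ℂ :=
  (2 * ε) ^ (m / 2) * (ascPochhammer ℂ ((m + 1) / 2)).eval (-ε)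

/-- The normalized rotationally symmetric form
`dΩ^{(m)} = c_{m-1} r^{δ_{m,odd}} dz₁ ∧ … ∧ dz_m / (r² + z²)^⌊(m+1)/2⌋`. -/
def dOmega (m : ℕ) (r ε : ℂ) : Form (roundQuadric m r) m :=
  (sphereConstant m ε * r ^ (if Odd m then 1 else 0)) • sphereForm (roundQuadric m r)

end TwistedDeRham

end

/-! A top form is `f dz₁ ∧ … ∧ dz_m` with `f = p / G ^ k`, and it is exact precisely when `f` is a
sum of covariant partial derivatives. Since `G ^ s p / G ^ k = p G ^ (s - k)`, these derivatives
have numerators `G ∂_i p + l (∂_i G) p` with `l = s - k` (`covDeriv_divPow`), so everything reduces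
to the quotient of the polynomial ring by `exactPoly G l`. No factor met below vanishes, because
`2l` is never an integer.

If `det A ≠ 0`, an affine change of variables gives `G = ρ + ∑ z_i²` with `ρ = r²`. The Euler field
yields `(n + m + 2l) f G ≡ 2lρ f` for `f` homogeneous of degree `n`. For `ρ = 0` every `f G` is
exact, so the cohomology vanishes. For `ρ ≠ 0` induction on the degree reduces every polynomial to a
constant (`exactPoly_sup_span_one`), and a functional imitating integration kills exact polynomials
but not `1` (`sphereIntegral_exact`). Any power of `G` can replace `1`, whence the generator.

If `det A = 0`, take `v ≠ 0` with `A v = 0`. Then `G` has constant derivative along `v`, and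
integrating along `v` shows that every `f G` is exact. -/

noncomputable section

namespace TwistedDeRham

variable {m : ℕ}

/-! ### Exact polynomials -/

/-- The numerator of `∂_i (p G ^ l)`, that is, `G ∂_i p + l (∂_i G) p`. -/
def twistedPderiv (G : MvPolynomial (Fin m) ℂ) (l : ℂ) (i : Fin m) :
    MvPolynomial (Fin m) ℂ →ₗ[ℂ] MvPolynomial (Fin m) ℂ :=
  LinearMap.mulLeft ℂ G ∘ₗ (pderiv i).toLinearMap + l • LinearMap.mulLeft ℂ (pderiv i G)

theorem twistedPderiv_apply (G : MvPolynomial (Fin m) ℂ) (l : ℂ) (i : Fin m)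
    (p : MvPolynomial (Fin m) ℂ) :
    twistedPderiv G l i p = G * pderiv i p + l • (pderiv i G * p) := by
  simp [twistedPderiv]

/-- The span of the numerators of the derivatives of `p G ^ l`, for `p` a polynomial. -/
def exactPoly (G : MvPolynomial (Fin m) ℂ) (l : ℂ) : Submodule ℂ (MvPolynomial (Fin m) ℂ) :=
  ⨆ i, LinearMap.range (twistedPderiv G l i)

theorem twistedPderiv_mem_exactPoly (G : MvPolynomial (Fin m) ℂ) (l : ℂ) (i : Fin m)
    (p : MvPolynomial (Fin m) ℂ) : twistedPderiv G l i p ∈ exactPoly G l :=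
  Submodule.mem_iSup_of_mem i ⟨p, rfl⟩

theorem exactPoly_le {G : MvPolynomial (Fin m) ℂ} {l : ℂ}
    {S : Submodule ℂ (MvPolynomial (Fin m) ℂ)} (h : ∀ i p, twistedPderiv G l i p ∈ S) :
    exactPoly G l ≤ S :=
  iSup_le fun i => by
    rintro _ ⟨p, rfl⟩
    exact h i p

/-! ### The quadric `ρ + z₁² + … + z_m²` -/

/-- The quadric `ρ + z₁² + … + z_m²`. -/
def diagQuadric (m : ℕ) (ρ : ℂ) : MvPolynomial (Fin m) ℂ :=
  C ρ + ∑ i, X i ^ 2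

theorem pderiv_diagQuadric (ρ : ℂ) (i : Fin m) : pderiv i (diagQuadric m ρ) = 2 * X i := by
  classical
  simp [diagQuadric, pderiv_X, Pi.single_apply]

theorem intCast_add_two_mul_ne_zero {l : ℂ} (hl : ∀ k : ℤ, 2 * l ≠ k) (n : ℤ) :
    (n : ℂ) + 2 * l ≠ 0 := fun h => hl (-n) (by push_cast; linear_combination h)

theorem add_natCast_ne_zero {l : ℂ} (hl : ∀ k : ℤ, 2 * l ≠ k) (n : ℕ) :
    l + n ≠ 0 := fun h => hl (-2 * n) (by push_cast; linear_combination 2 * h)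

/-- The exact form obtained by contracting with the Euler vector field. -/
theorem euler_mem_exactPoly (ρ l : ℂ) (f : MvPolynomial (Fin m) ℂ) :
    (∑ i, X i * pderiv i f) * diagQuadric m ρ + ((m : ℂ) + 2 * l) • (f * diagQuadric m ρ) -
      (2 * l * ρ) • f ∈ exactPoly (diagQuadric m ρ) l := by
  -- The divergence of the field `f z`: the terms `2l z_i² f` add up to `2l (G - ρ) f`.
  have h : ∑ i, twistedPderiv (diagQuadric m ρ) l i (X i * f) ∈
      exactPoly (diagQuadric m ρ) l :=
    Submodule.sum_mem _ fun i _ => twistedPderiv_mem_exactPoly _ _ _ _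
  convert h using 1
  have hX : ∑ i, (X i : MvPolynomial (Fin m) ℂ) ^ 2 = diagQuadric m ρ - C ρ := by
    simp [diagQuadric]
  have h1 : ∀ i, twistedPderiv (diagQuadric m ρ) l i (X i * f) =
      diagQuadric m ρ * f + X i * pderiv i f * diagQuadric m ρ + C (2 * l) * f * X i ^ 2 := by
    intro i
    rw [twistedPderiv_apply, pderiv_diagQuadric, pderiv_mul, pderiv_X_self, smul_eq_C_mul,
      C_mul, map_ofNat]
    ring
  simp only [h1, Finset.sum_add_distrib, ← Finset.mul_sum, hX, ← Finset.sum_mul, smul_eq_C_mul,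
    C_mul, C_add, map_ofNat, Finset.sum_const, Finset.card_univ, Fintype.card_fin,
    nsmul_eq_mul, map_natCast]
  ring

theorem homogeneous_mul_mem_exactPoly (ρ l : ℂ) {f : MvPolynomial (Fin m) ℂ} {n : ℕ}
    (hf : f.IsHomogeneous n) :
    (((n + m : ℕ) : ℂ) + 2 * l) • (f * diagQuadric m ρ) - (2 * l * ρ) • f ∈
      exactPoly (diagQuadric m ρ) l := by
  convert euler_mem_exactPoly ρ l f using 1
  rw [hf.sum_X_mul_pderiv]
  push_cast
  rw [add_assoc, add_smul (n : ℂ), smul_mul_assoc, Nat.cast_smul_eq_nsmul]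

/-- For `ρ = 0` the Euler relation has only the term in `f G`, with nonzero coefficient on each
homogeneous component. -/
theorem mul_cone_mem_exactPoly {l : ℂ} (hl : ∀ k : ℤ, 2 * l ≠ k)
    (f : MvPolynomial (Fin m) ℂ) : f * diagQuadric m 0 ∈ exactPoly (diagQuadric m 0) l := by
  rw [← f.sum_homogeneousComponent, Finset.sum_mul]
  refine Submodule.sum_mem _ fun n _ => ?_
  have := homogeneous_mul_mem_exactPoly 0 l (homogeneousComponent_isHomogeneous n f)
  rw [mul_zero, zero_smul, sub_zero] at this
  exact (Submodule.smul_mem_iff _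
    (by exact_mod_cast intCast_add_two_mul_ne_zero hl ((n + m : ℕ) : ℤ))).1 this

/-- Induction on the degree. Euler's identity writes `n f` as `∑ z_i ∂_i f`; modulo exact
polynomials `2l z_i ∂_i f ≡ -G ∂_i² f`, and the Euler relation makes this a multiple of `∂_i² f`, of
degree `n - 2`. -/
theorem exactPoly_sup_span_one {l : ℂ} (hl : ∀ k : ℤ, 2 * l ≠ k) (ρ : ℂ) :
    exactPoly (diagQuadric m ρ) l ⊔ Submodule.span ℂ {1} = ⊤ := by
  set B := exactPoly (diagQuadric m ρ) l ⊔ Submodule.span ℂ {1} with hB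
  have hle : exactPoly (diagQuadric m ρ) l ≤ B := le_sup_left
  have hl0 : l ≠ 0 := by simpa using add_natCast_ne_zero hl 0
  have key : ∀ n, ∀ f : MvPolynomial (Fin m) ℂ, f.IsHomogeneous n → f ∈ B := by
    intro n
    induction n using Nat.strong_induction_on with
    | _ n ih =>
      intro f hf
      rcases Nat.eq_zero_or_pos n with rfl | hn
      · refine Submodule.mem_sup_right (Submodule.mem_span_singleton.2 ⟨coeff 0 f, ?_⟩)
        rw [smul_eq_C_mul, mul_one]
        exact (totalDegree_eq_zero_iff_eq_C.1 ((totalDegree_zero_iff_isHomogeneous _).2 hf)).symm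
      · have h1 : n • f ∈ B := by
          rw [← hf.sum_X_mul_pderiv]
          refine Submodule.sum_mem _ fun i _ => ?_
          -- For `n = 1` the subtraction truncates to `0`, which is harmless: the index is still
          -- below `n`.
          have hd : (pderiv i (pderiv i f)).IsHomogeneous (n - 1 - 1) := hf.pderiv.pderiv
          have h2 : pderiv i (pderiv i f) * diagQuadric m ρ ∈ B := by
            have h3 := Submodule.add_mem _ (hle (homogeneous_mul_mem_exactPoly ρ l hd))
              (Submodule.smul_mem _ (2 * l * ρ) (ih _ (by omega) _ hd))
            rw [sub_add_cancel] at h3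
            exact (Submodule.smul_mem_iff _ (by
              exact_mod_cast intCast_add_two_mul_ne_zero hl ((n - 1 - 1 + m : ℕ) : ℤ))).1 h3
          have h4 := Submodule.sub_mem _
            (hle (twistedPderiv_mem_exactPoly (diagQuadric m ρ) l i (pderiv i f))) h2
          rw [twistedPderiv_apply, pderiv_diagQuadric, mul_comm (diagQuadric m ρ),
            add_sub_cancel_left, mul_assoc, ← map_ofNat C, C_mul', smul_smul] at h4
          exact (Submodule.smul_mem_iff _ (mul_ne_zero hl0 two_ne_zero)).1 h4
        rw [← Nat.cast_smul_eq_nsmul ℂ] at h1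
        exact (Submodule.smul_mem_iff _ (by exact_mod_cast hn.ne')).1 h1
  refine eq_top_iff.2 fun f _ => ?_
  rw [← f.sum_homogeneousComponent]
  exact Submodule.sum_mem _ fun n _ => key n _ (homogeneousComponent_isHomogeneous n f)

/-- The ratio of `G ^ (j + 1)` and `G ^ j` modulo exact polynomials. -/
theorem diagQuadric_pow_succ_mem (ρ l : ℂ) (j : ℕ) :
    (((2 * j + m : ℕ) : ℂ) + 2 * l) • diagQuadric m ρ ^ (j + 1) -
      (2 * (l + j) * ρ) • diagQuadric m ρ ^ j ∈ exactPoly (diagQuadric m ρ) l := by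
  convert euler_mem_exactPoly ρ l (diagQuadric m ρ ^ j) using 1
  have hX : ∑ i, (X i : MvPolynomial (Fin m) ℂ) ^ 2 = diagQuadric m ρ - C ρ := by
    simp [diagQuadric]
  rcases j with _ | j
  · simp
  have h1 : ∀ i : Fin m, X i * pderiv i (diagQuadric m ρ ^ (j + 1)) =
      (2 * ((j : MvPolynomial (Fin m) ℂ) + 1) * diagQuadric m ρ ^ j) * X i ^ 2 := by
    intro i
    rw [pderiv_pow, pderiv_diagQuadric, Nat.add_sub_cancel]
    push_cast
    ring
  simp only [h1, ← Finset.mul_sum, hX, smul_eq_C_mul, C_mul, C_add, map_ofNat, map_natCast]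
  push_cast
  ring

/-! ### The functional that detects the nonzero class -/

/-- The scalar `(n - 1)!!` for even `n` and `0` for odd `n`: the moments of a normal variable. -/
def gaussMoment : ℕ → ℂ
  | 0 => 1
  | 1 => 0
  | n + 2 => (n + 1) * gaussMoment n

/-- The radial factor of the integral of a monomial of degree `n` against `G ^ (l - 1)`. -/
def radialMoment (m : ℕ) (ρ l : ℂ) : ℕ → ℂ
  | 0 => 1
  -- An arbitrary value: a monomial of odd degree has an odd exponent, whose Gaussian moment is
  -- zero.
  | 1 => 1
  -- The recursion forced by vanishing on exact polynomials.
  | n + 2 => -ρ * radialMoment m ρ l n / (((n + m : ℕ) : ℂ) + 2 * l)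

/-- The algebraic analogue of integration against `(ρ + z₁² + … + z_m²) ^ (l - 1)`. -/
def sphereIntegral (m : ℕ) (ρ l : ℂ) : MvPolynomial (Fin m) ℂ →ₗ[ℂ] ℂ :=
  (basisMonomials (Fin m) ℂ).constr ℂ fun α =>
    radialMoment m ρ l α.degree * ∏ i, gaussMoment (α i)

theorem sphereIntegral_monomial (ρ l : ℂ) (α : Fin m →₀ ℕ) :
    sphereIntegral m ρ l (monomial α 1) =
      radialMoment m ρ l α.degree * ∏ i, gaussMoment (α i) := by
  have := (basisMonomials (Fin m) ℂ).constr_basis ℂ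
    (fun α => radialMoment m ρ l α.degree * ∏ i, gaussMoment (α i)) α
  rwa [coe_basisMonomials] at this

theorem sphereIntegral_one (ρ l : ℂ) : sphereIntegral m ρ l 1 = 1 := by
  have := sphereIntegral_monomial (m := m) ρ l 0
  simpa [radialMoment, gaussMoment] using this

theorem sphereIntegral_monomial_mul_sq (ρ l : ℂ) (α : Fin m →₀ ℕ) (j : Fin m) :
    sphereIntegral m ρ l (monomial α 1 * X j ^ 2) =
      radialMoment m ρ l (α.degree + 2) * ((α j + 1) * ∏ i, gaussMoment (α i)) := by
  rw [X_pow_eq_monomial, monomial_mul, one_mul, sphereIntegral_monomial, map_add,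
    Finsupp.degree_single]
  congr 1
  rw [← Finset.mul_prod_erase _ _ (Finset.mem_univ j),
    ← Finset.mul_prod_erase _ (fun i => gaussMoment (α i)) (Finset.mem_univ j), ← mul_assoc]
  congr 1
  · simp [gaussMoment]
  · refine Finset.prod_congr rfl fun i hi => ?_
    simp [Finsupp.single_eq_of_ne (Finset.ne_of_mem_erase hi)]

/-- Tested on monomials `z^α`. If `α i = 0`, the surviving term has exponent `1` in `z_i` and moment
zero. Otherwise `α = β + e_i`, and with `n = |β|` a common factor leaves `ρ R(n) + (n + m + 2l) R(n
+ 2)`, where `R` is `radialMoment`; this is zero. -/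
theorem sphereIntegral_exact {l : ℂ} (hl : ∀ k : ℤ, 2 * l ≠ k) (ρ : ℂ)
    {f : MvPolynomial (Fin m) ℂ} (hf : f ∈ exactPoly (diagQuadric m ρ) l) :
    sphereIntegral m ρ l f = 0 := by
  suffices h : ∀ i, sphereIntegral m ρ l ∘ₗ twistedPderiv (diagQuadric m ρ) l i = 0 from
    exactPoly_le (S := LinearMap.ker (sphereIntegral m ρ l))
      (fun i p => LinearMap.congr_fun (h i) p) hf
  intro i
  refine (basisMonomials (Fin m) ℂ).ext fun α => ?_
  rw [coe_basisMonomials, LinearMap.comp_apply, twistedPderiv_apply, pderiv_diagQuadric,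
    LinearMap.zero_apply, pderiv_monomial, one_mul]
  rcases Nat.eq_zero_or_pos (α i) with h0 | h0
  · rw [h0, Nat.cast_zero, monomial_zero, mul_zero, zero_add, ← map_ofNat C, mul_assoc, C_mul',
      map_smul, map_smul, mul_comm, X, monomial_mul, one_mul, sphereIntegral_monomial,
      Finset.prod_eq_zero (Finset.mem_univ i) (by simp [h0, gaussMoment]), mul_zero, smul_zero,
      smul_zero]
  · obtain ⟨β, rfl⟩ : ∃ β : Fin m →₀ ℕ, α = β + Finsupp.single i 1 :=
      ⟨α - Finsupp.single i 1, (tsub_add_cancel_of_le (by simpa using Nat.succ_le_of_lt h0)).symm⟩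
    have e1 : diagQuadric m ρ * monomial (β + Finsupp.single i 1 - Finsupp.single i 1)
        (((β + Finsupp.single i 1 : Fin m →₀ ℕ) i : ℕ) : ℂ) =
        ((β i : ℂ) + 1) • (ρ • monomial β 1 + ∑ j, monomial β 1 * X j ^ 2) := by
      rw [add_tsub_cancel_right, ← Finset.mul_sum]
      have : monomial β (((β + Finsupp.single i 1 : Fin m →₀ ℕ) i : ℕ) : ℂ) =
          C ((β i : ℂ) + 1) * monomial β 1 := by
        rw [C_mul_monomial, mul_one]; simp
      rw [this, diagQuadric, smul_eq_C_mul, smul_eq_C_mul]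
      ring
    have e2 : l • (2 * X i * monomial (β + Finsupp.single i 1) (1 : ℂ)) =
        (2 * l) • (monomial β 1 * X i ^ 2) := by
      rw [monomial_add_single, smul_eq_C_mul, smul_eq_C_mul, C_mul, map_ofNat]
      ring
    rw [e1, e2, map_add, map_smul, map_add, map_smul, map_sum, map_smul]
    simp only [sphereIntegral_monomial_mul_sq, sphereIntegral_monomial, ← Finset.mul_sum,
      ← Finset.sum_mul, Finset.sum_add_distrib, smul_eq_mul]
    have hdeg : ∑ j, ((β j : ℕ) : ℂ) = β.degree := by
      rw [Finsupp.degree_eq_sum]; push_cast; rfl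
    have hne : ((β.degree + m : ℕ) : ℂ) + 2 * l ≠ 0 := by
      exact_mod_cast intCast_add_two_mul_ne_zero hl ((β.degree + m : ℕ) : ℤ)
    rw [hdeg, radialMoment]
    simp only [Finset.sum_const, Finset.card_univ, Fintype.card_fin, nsmul_eq_mul, mul_one]
    push_cast at hne ⊢
    field_simp
    ring

/-- The functional takes the value `1` on `1`. Exactness of `G ^ (j + 1)` would force that of `G ^
j`, whose coefficient `2(l + j)ρ` in the ratio relation is nonzero. -/
theorem diagQuadric_pow_notMem {l : ℂ} (hl : ∀ k : ℤ, 2 * l ≠ k) {ρ : ℂ} (hρ : ρ ≠ 0) (j : ℕ) :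
    diagQuadric m ρ ^ j ∉ exactPoly (diagQuadric m ρ) l := by
  induction j with
  | zero =>
    intro h
    have := sphereIntegral_exact hl ρ h
    rw [pow_zero, sphereIntegral_one] at this
    exact one_ne_zero this
  | succ j ih =>
    intro h
    have h1 := diagQuadric_pow_succ_mem (m := m) ρ l j
    rw [Submodule.sub_mem_iff_right _ (Submodule.smul_mem _ _ h)] at h1
    exact ih ((Submodule.smul_mem_iff _ (mul_ne_zero (mul_ne_zero two_ne_zero
      (add_natCast_ne_zero hl j)) hρ)).1 h1)

theorem exactPoly_sup_span_pow {l : ℂ} (hl : ∀ k : ℤ, 2 * l ≠ k) {ρ : ℂ} (hρ : ρ ≠ 0) (j : ℕ) :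
    exactPoly (diagQuadric m ρ) l ⊔ Submodule.span ℂ {diagQuadric m ρ ^ j} = ⊤ := by
  induction j with
  | zero => rw [pow_zero, exactPoly_sup_span_one hl]
  | succ j ih =>
    rw [eq_top_iff, ← ih, sup_le_iff]
    refine ⟨le_sup_left, Submodule.span_le.2 (Set.singleton_subset_iff.2 ?_)⟩
    have h1 := Submodule.mem_sup_left (T := Submodule.span ℂ {diagQuadric m ρ ^ (j + 1)})
      (diagQuadric_pow_succ_mem (m := m) ρ l j)
    rw [Submodule.sub_mem_iff_right _ (Submodule.smul_mem _ _
      (Submodule.mem_sup_right (Submodule.mem_span_singleton_self _)))] at h1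
    exact (Submodule.smul_mem_iff _ (mul_ne_zero (mul_ne_zero two_ne_zero
      (add_natCast_ne_zero hl j)) hρ)).1 h1

/-! ### Affine substitutions -/

/-- The substitution `z ↦ M z + t` in polynomials. -/
def affineSubst (M : Matrix (Fin m) (Fin m) ℂ) (t : Fin m → ℂ) :
    MvPolynomial (Fin m) ℂ →ₐ[ℂ] MvPolynomial (Fin m) ℂ :=
  aeval fun i => ∑ j, C (M i j) * X j + C (t i)

theorem eval_affineSubst (M : Matrix (Fin m) (Fin m) ℂ) (t x : Fin m → ℂ)
    (p : MvPolynomial (Fin m) ℂ) :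
    eval x (affineSubst M t p) = eval (M.mulVec x + t) p := by
  have : (eval x).comp (affineSubst M t : MvPolynomial (Fin m) ℂ →+* _) = eval (M.mulVec x + t) := by
    refine MvPolynomial.ringHom_ext (fun r => ?_) fun i => ?_ <;>
      simp [affineSubst, Matrix.mulVec, dotProduct]
  exact RingHom.congr_fun this p

theorem pderiv_affineSubst (M : Matrix (Fin m) (Fin m) ℂ) (t : Fin m → ℂ) (i : Fin m)
    (p : MvPolynomial (Fin m) ℂ) :
    pderiv i (affineSubst M t p) = ∑ j, M j i • affineSubst M t (pderiv j p) := by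
  classical
  induction p using MvPolynomial.induction_on with
  | C a => simp [affineSubst]
  | add p q hp hq => simp only [map_add, hp, hq, smul_add, Finset.sum_add_distrib]
  | mul_X p k hp =>
    have hX : pderiv i (affineSubst M t (X k)) = C (M k i) := by
      simp [affineSubst, pderiv_X, Pi.single_apply]
    rw [map_mul, pderiv_mul, hp, hX]
    simp only [pderiv_mul, map_add, map_mul, smul_add, Finset.sum_add_distrib, pderiv_X,
      Pi.single_apply, Finset.sum_mul, smul_mul_assoc]
    congr 1
    simp [mul_comm, C_mul']

/-- By the chain rule, inverted with `N`, the substitution takes each generator to a constant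
combination of generators for the new quadric. -/
theorem affineSubst_mem_exactPoly {M N : Matrix (Fin m) (Fin m) ℂ} (hMN : M * N = 1)
    (t : Fin m → ℂ) {G : MvPolynomial (Fin m) ℂ} {l : ℂ} {f : MvPolynomial (Fin m) ℂ}
    (hf : f ∈ exactPoly G l) :
    affineSubst M t f ∈ exactPoly (affineSubst M t G) l := by
  refine exactPoly_le (S := (exactPoly (affineSubst M t G) l).comap
    (affineSubst M t).toLinearMap) (fun i p => ?_) hf
  have hd : ∀ q, affineSubst M t (pderiv i q) =
      ∑ k, N k i • pderiv k (affineSubst M t q) := by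
    intro q
    simp only [pderiv_affineSubst, Finset.smul_sum, smul_smul]
    rw [Finset.sum_comm]
    simp only [← Finset.sum_smul]
    have : ∀ j, ∑ k, N k i * M j k = if j = i then 1 else 0 := by
      intro j
      have := congr_fun (congr_fun hMN j) i
      rw [Matrix.mul_apply, Matrix.one_apply] at this
      simpa only [mul_comm] using this
    simp [this]
  have : affineSubst M t (twistedPderiv G l i p) =
      ∑ k, N k i • twistedPderiv (affineSubst M t G) l k (affineSubst M t p) := by
    simp only [twistedPderiv_apply, map_add, map_mul, map_smul, hd, Finset.mul_sum,
      Finset.sum_mul, Finset.smul_sum, smul_add, Finset.sum_add_distrib, mul_smul_comm,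
      smul_mul_assoc, smul_comm l]
  rw [Submodule.mem_comap, AlgHom.toLinearMap_apply, this]
  exact Submodule.sum_mem _ fun k _ => Submodule.smul_mem _ _ (twistedPderiv_mem_exactPoly _ _ _ _)

/-- An affine change of coordinates takes `G` to `H`. -/
def AffineEquivalent (G H : MvPolynomial (Fin m) ℂ) : Prop :=
  ∃ (M N : Matrix (Fin m) (Fin m) ℂ) (t : Fin m → ℂ), M * N = 1 ∧ affineSubst M t G = H

theorem affineSubst_affineSubst {M N : Matrix (Fin m) (Fin m) ℂ} (hMN : M * N = 1)
    (t : Fin m → ℂ) (p : MvPolynomial (Fin m) ℂ) :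
    affineSubst N (-N.mulVec t) (affineSubst M t p) = p := by
  refine MvPolynomial.funext fun x => ?_
  rw [eval_affineSubst, eval_affineSubst, Matrix.mulVec_add, Matrix.mulVec_neg,
    Matrix.mulVec_mulVec, Matrix.mulVec_mulVec, hMN, Matrix.one_mulVec, Matrix.one_mulVec,
    neg_add_cancel_right]

theorem mul_mem_exactPoly_of_affineEquivalent {G : MvPolynomial (Fin m) ℂ}
    (hG : AffineEquivalent G (diagQuadric m 0)) {l : ℂ} (hl : ∀ k : ℤ, 2 * l ≠ k)
    (f : MvPolynomial (Fin m) ℂ) : f * G ∈ exactPoly G l := by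
  obtain ⟨M, N, t, hMN, h⟩ := hG
  have h1 := affineSubst_mem_exactPoly (mul_eq_one_comm.1 hMN) (-N.mulVec t)
    (mul_cone_mem_exactPoly hl (affineSubst M t f))
  rwa [← h, ← map_mul, affineSubst_affineSubst hMN, affineSubst_affineSubst hMN] at h1

theorem pow_notMem_exactPoly_of_affineEquivalent {G : MvPolynomial (Fin m) ℂ} {ρ : ℂ}
    (hG : AffineEquivalent G (diagQuadric m ρ)) {l : ℂ} (hl : ∀ k : ℤ, 2 * l ≠ k) (hρ : ρ ≠ 0)
    (j : ℕ) : G ^ j ∉ exactPoly G l := by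
  obtain ⟨M, N, t, hMN, h⟩ := hG
  intro h1
  have h2 := affineSubst_mem_exactPoly hMN t h1
  rw [map_pow, h] at h2
  exact diagQuadric_pow_notMem hl hρ j h2

theorem exactPoly_sup_span_pow_of_affineEquivalent {G : MvPolynomial (Fin m) ℂ} {ρ : ℂ}
    (hG : AffineEquivalent G (diagQuadric m ρ)) {l : ℂ} (hl : ∀ k : ℤ, 2 * l ≠ k) (hρ : ρ ≠ 0)
    (j : ℕ) : exactPoly G l ⊔ Submodule.span ℂ {G ^ j} = ⊤ := by
  obtain ⟨M, N, t, hMN, h⟩ := hG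
  refine eq_top_iff.2 fun f _ => ?_
  have hf : affineSubst M t f ∈ (⊤ : Submodule ℂ _) := trivial
  rw [← exactPoly_sup_span_pow hl hρ j, Submodule.mem_sup] at hf
  obtain ⟨y, hy, z, hz, hyz⟩ := hf
  obtain ⟨a, rfl⟩ := Submodule.mem_span_singleton.1 hz
  have h1 := affineSubst_mem_exactPoly (mul_eq_one_comm.1 hMN) (-N.mulVec t) hy
  have h2 := congr_arg (affineSubst N (-N.mulVec t)) hyz
  rw [map_add, affineSubst_affineSubst hMN, map_smul, map_pow, ← h,
    affineSubst_affineSubst hMN] at h2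
  rw [← h, affineSubst_affineSubst hMN] at h1
  rw [← h2]
  exact Submodule.add_mem_sup h1 (Submodule.smul_mem _ _ (Submodule.mem_span_singleton_self _))

/-! ### Nondegenerate quadrics -/

theorem eval_quadric (A : Matrix (Fin m) (Fin m) ℂ) (b : Fin m → ℂ) (c : ℂ) (x : Fin m → ℂ) :
    eval x (quadric A b c) = x ⬝ᵥ A.mulVec x + 2 * b ⬝ᵥ x + c := by
  simp only [quadric, Matrix.mulVec, dotProduct, map_add, map_sum, map_mul, eval_C, eval_X,
    Finset.mul_sum]
  congr 2
  exact Finset.sum_congr rfl fun i _ => Finset.sum_congr rfl fun j _ => by ring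

/-- A nondegenerate symmetric form over `ℂ` is isometric to a sum of squares; `M` is the matrix of
the inverse isometry. -/
theorem exists_orthonormalizing_matrix {A : Matrix (Fin m) (Fin m) ℂ} (hA : A.IsSymm)
    (hdet : A.det ≠ 0) :
    ∃ M N : Matrix (Fin m) (Fin m) ℂ, M * N = 1 ∧
      ∀ x, M.mulVec x ⬝ᵥ A.mulVec (M.mulVec x) = ∑ i, x i ^ 2 := by
  set B : LinearMap.BilinForm ℂ (Fin m → ℂ) := Matrix.toLinearMap₂' ℂ A with hB
  have hBapp : ∀ x y, B x y = x ⬝ᵥ A.mulVec y := fun x y => Matrix.toLinearMap₂'_apply' A x y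
  have hsymm : ∀ x y, B x y = B y x := by
    intro x y
    rw [hBapp, hBapp, Matrix.dotProduct_mulVec, ← Matrix.mulVec_transpose, hA.eq, dotProduct_comm]
  have hsep : (QuadraticMap.associated (R := ℂ) B.toQuadraticMap).SeparatingLeft := by
    rw [QuadraticMap.associated_left_inverse ℂ hsymm, hB, Matrix.separatingLeft_toLinearMap₂'_iff,
      Matrix.separatingLeft_iff_det_ne_zero]
    exact hdet
  have h := QuadraticForm.equivalent_weightedSumSquares_of_isAlgClosed _ hsep
  rw [Module.finrank_fin_fun] at h
  obtain ⟨e⟩ := h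
  refine ⟨LinearMap.toMatrix' e.toLinearEquiv.symm.toLinearMap,
    LinearMap.toMatrix' e.toLinearEquiv.toLinearMap, ?_, fun x => ?_⟩
  · rw [← LinearMap.toMatrix'_comp, LinearEquiv.symm_comp, LinearMap.toMatrix'_id]
  · rw [LinearMap.toMatrix'_mulVec, ← hBapp]
    have h1 := e.map_app (e.toLinearEquiv.symm x)
    have h2 : e (e.toLinearEquiv.symm x) = x := e.toLinearEquiv.apply_symm_apply x
    rw [h2, QuadraticMap.weightedSumSquares_apply] at h1
    simp only [LinearMap.BilinMap.toQuadraticMap_apply] at h1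
    rw [LinearEquiv.coe_coe, ← h1]
    simp [sq]

/-- Schur complement. The right side is the value of the quadric at its centre `-A⁻¹ b`. -/
theorem det_borderedMatrix (A : Matrix (Fin m) (Fin m) ℂ) (b : Fin m → ℂ) (c : ℂ)
    (hdet : A.det ≠ 0) : (borderedMatrix A b c).det / A.det = c - b ⬝ᵥ A⁻¹.mulVec b := by
  let _ : Invertible A := A.invertibleOfIsUnitDet (Ne.isUnit hdet)
  rw [borderedMatrix, Matrix.det_fromBlocks₁₁, mul_div_cancel_left₀ _ hdet, Matrix.det_unique,
    Matrix.invOf_eq_nonsing_inv, Matrix.mul_assoc]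
  rfl

theorem affineEquivalent_diagQuadric {A : Matrix (Fin m) (Fin m) ℂ} (hA : A.IsSymm)
    (hdet : A.det ≠ 0) (b : Fin m → ℂ) (c : ℂ) :
    AffineEquivalent (quadric A b c)
      (diagQuadric m ((borderedMatrix A b c).det / A.det)) := by
  obtain ⟨M, N, hMN, h⟩ := exists_orthonormalizing_matrix hA hdet
  -- Completing the square: translation to the centre removes the linear term.
  refine ⟨M, N, -A⁻¹.mulVec b, hMN, MvPolynomial.funext fun x => ?_⟩
  have hAb : A.mulVec (A⁻¹.mulVec b) = b := by
    rw [Matrix.mulVec_mulVec, Matrix.mul_nonsing_inv _ (Ne.isUnit hdet), Matrix.one_mulVec]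
  have hAbx : A⁻¹.mulVec b ⬝ᵥ A.mulVec (M.mulVec x) = b ⬝ᵥ M.mulVec x := by
    rw [Matrix.dotProduct_mulVec, ← Matrix.mulVec_transpose, hA.eq, hAb]
  rw [eval_affineSubst, eval_quadric, det_borderedMatrix A b c hdet, Matrix.mulVec_add,
    Matrix.mulVec_neg, hAb]
  simp only [add_dotProduct, dotProduct_add, neg_dotProduct, dotProduct_neg, h, hAbx,
    dotProduct_comm (M.mulVec x) b, dotProduct_comm (A⁻¹.mulVec b) b, diagQuadric, map_add,
    map_sum, map_pow, eval_C, eval_X]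
  ring

/-! ### Degenerate quadrics -/

/-- The derivative of polynomials along a constant vector. -/
def dirDeriv (v : Fin m → ℂ) :
    Derivation ℂ (MvPolynomial (Fin m) ℂ) (MvPolynomial (Fin m) ℂ) :=
  mkDerivation ℂ fun i => C (v i)

theorem dirDeriv_apply (v : Fin m → ℂ) (p : MvPolynomial (Fin m) ℂ) :
    dirDeriv v p = ∑ i, v i • pderiv i p := by
  induction p using MvPolynomial.induction_on with
  | C a => simp [dirDeriv]
  | add p q hp hq => simp only [map_add, hp, hq, smul_add, Finset.sum_add_distrib]
  | mul_X p k hp =>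
    classical
    have hX : dirDeriv v (X k) = C (v k) := by simp [dirDeriv]
    rw [Derivation.leibniz, hp, hX]
    simp only [pderiv_mul, smul_add, Finset.sum_add_distrib, pderiv_X, Pi.single_apply,
      smul_eq_mul, Finset.mul_sum]
    rw [add_comm]
    congr 1
    · exact Finset.sum_congr rfl fun i _ => by rw [mul_comm, smul_mul_assoc]
    · simp [smul_eq_C_mul, mul_comm]

theorem dirDeriv_X (v : Fin m → ℂ) (i : Fin m) : dirDeriv v (X i) = C (v i) := by
  simp [dirDeriv]

theorem dirDeriv_mem_exactPoly (G : MvPolynomial (Fin m) ℂ) (l : ℂ) (v : Fin m → ℂ)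
    (p : MvPolynomial (Fin m) ℂ) :
    G * dirDeriv v p + l • (dirDeriv v G * p) ∈ exactPoly G l := by
  have : G * dirDeriv v p + l • (dirDeriv v G * p) = ∑ i, v i • twistedPderiv G l i p := by
    simp only [dirDeriv_apply, twistedPderiv_apply, smul_add, Finset.sum_add_distrib,
      Finset.mul_sum, Finset.sum_mul, Finset.smul_sum, mul_smul_comm, smul_mul_assoc,
      smul_comm l]
  rw [this]
  exact Submodule.sum_mem _ fun i _ => Submodule.smul_mem _ _ (twistedPderiv_mem_exactPoly _ _ _ _)

theorem exists_iterate_dirDeriv_eq_zero (v : Fin m → ℂ) (p : MvPolynomial (Fin m) ℂ) :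
    ∃ n, (dirDeriv v)^[n] p = 0 := by
  have hzero : ∀ k, (dirDeriv v)^[k] 0 = 0 := fun k => iterate_map_zero _ k
  have hmono : ∀ {n k : ℕ} {q : MvPolynomial (Fin m) ℂ}, n ≤ k → (dirDeriv v)^[n] q = 0 →
      (dirDeriv v)^[k] q = 0 := by
    intro n k q hnk hq
    rw [← Nat.sub_add_cancel hnk, Function.iterate_add_apply, hq, hzero]
  induction p using MvPolynomial.induction_on with
  | C a => exact ⟨1, by simp [dirDeriv]⟩
  | add p q hp hq =>
    obtain ⟨n, hn⟩ := hp
    obtain ⟨k, hk⟩ := hq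
    exact ⟨max n k, by rw [iterate_map_add, hmono (le_max_left _ _) hn,
      hmono (le_max_right _ _) hk, add_zero]⟩
  | mul_X p i hp =>
    obtain ⟨n, hn⟩ := hp
    -- Leibniz has only two terms, because the derivative of `X i` is constant.
    have key : ∀ k, (dirDeriv v)^[k + 1] (p * X i) =
        (dirDeriv v)^[k + 1] p * X i + ((k + 1 : ℕ) * v i : ℂ) • (dirDeriv v)^[k] p := by
      intro k
      induction k with
      | zero => simp [Derivation.leibniz, dirDeriv_X, smul_eq_C_mul]; ring
      | succ k ih =>
        rw [Function.iterate_succ_apply', ih, map_add, Derivation.leibniz, dirDeriv_X,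
          Derivation.map_smul, ← Function.iterate_succ_apply' (dirDeriv v) (k + 1),
          ← Function.iterate_succ_apply' (dirDeriv v) k]
        simp only [smul_eq_C_mul, smul_eq_mul, C_mul, map_natCast]
        push_cast
        ring
    exact ⟨n + 1, by rw [key, hn, hmono (Nat.le_succ n) hn, zero_mul, smul_zero, add_zero]⟩

/-- Integration by parts against a linear form `T` with derivative `1`: `D(T^(k+1) p) = (k+1) T^k p
+ T^(k+1) D p`. Each use trades `p` for `D p` and raises the power of `T`, hence the induction over
all `k`; it stops because `D` is locally nilpotent. -/
theorem dirDeriv_surjective {v : Fin m → ℂ} (hv : v ≠ 0) : Function.Surjective (dirDeriv v) := by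
  obtain ⟨i, hi⟩ := Function.ne_iff.1 hv
  have hi' : v i ≠ 0 := hi
  set T : MvPolynomial (Fin m) ℂ := C (v i)⁻¹ * X i with hT
  have hDT : dirDeriv v T = 1 := by
    rw [hT, C_mul', Derivation.map_smul, dirDeriv_X, smul_eq_C_mul, ← C_mul,
      inv_mul_cancel₀ hi', C_1]
  have key : ∀ n (p : MvPolynomial (Fin m) ℂ), (dirDeriv v)^[n] p = 0 →
      ∀ k : ℕ, T ^ k * p ∈ LinearMap.range (dirDeriv v).toLinearMap := by
    intro n
    induction n with
    | zero =>
      intro p hp k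
      rw [Function.iterate_zero_apply] at hp
      rw [hp, mul_zero]
      exact Submodule.zero_mem _
    | succ n ih =>
      intro p hp k
      have h1 := ih (dirDeriv v p) hp (k + 1)
      have h2 : dirDeriv v (T ^ (k + 1) * p) =
          ((k + 1 : ℕ) : ℂ) • (T ^ k * p) + T ^ (k + 1) * dirDeriv v p := by
        rw [Derivation.leibniz, Derivation.leibniz_pow, hDT]
        simp only [smul_eq_mul, nsmul_eq_mul, smul_eq_C_mul, map_natCast, Nat.add_sub_cancel]
        ring
      have h3 : dirDeriv v (T ^ (k + 1) * p) ∈ LinearMap.range (dirDeriv v).toLinearMap :=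
        ⟨_, rfl⟩
      rw [h2, Submodule.add_mem_iff_left _ h1] at h3
      exact (Submodule.smul_mem_iff _ (by exact_mod_cast k.succ_ne_zero)).1 h3
  intro p
  obtain ⟨n, hn⟩ := exists_iterate_dirDeriv_eq_zero v p
  simpa using key n p hn 0

theorem mul_mem_exactPoly_of_dirDeriv_eq_zero {G : MvPolynomial (Fin m) ℂ} {v : Fin m → ℂ}
    (hv : v ≠ 0) (hG : dirDeriv v G = 0) (l : ℂ) (f : MvPolynomial (Fin m) ℂ) :
    f * G ∈ exactPoly G l := by
  obtain ⟨p, rfl⟩ := dirDeriv_surjective hv f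
  have := dirDeriv_mem_exactPoly G l v p
  rwa [hG, zero_mul, smul_zero, add_zero, mul_comm] at this

/-- Modulo exact polynomials `(l + j) κ G^j p ≡ -G^(j+1) D p`. Iteration ends when a power of `D`
kills `p`. -/
theorem mem_exactPoly_of_dirDeriv_eq_C {G : MvPolynomial (Fin m) ℂ} {v : Fin m → ℂ} {κ : ℂ}
    (hκ : κ ≠ 0) (hG : dirDeriv v G = C κ) {l : ℂ} (hl : ∀ k : ℤ, 2 * l ≠ k)
    (f : MvPolynomial (Fin m) ℂ) : f ∈ exactPoly G l := by
  have step : ∀ (p : MvPolynomial (Fin m) ℂ) (j : ℕ), G ^ (j + 1) * dirDeriv v p ∈ exactPoly G l →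
      G ^ j * p ∈ exactPoly G l := by
    intro p j hp
    have h1 := dirDeriv_mem_exactPoly G l v (G ^ j * p)
    have h2 : G * dirDeriv v (G ^ j * p) + l • (dirDeriv v G * (G ^ j * p)) =
        G ^ (j + 1) * dirDeriv v p + ((l + j) * κ) • (G ^ j * p) := by
      rw [Derivation.leibniz, Derivation.leibniz_pow, hG]
      rcases j with _ | j
      · simp [smul_eq_C_mul]; ring
      · simp only [smul_eq_mul, nsmul_eq_mul, smul_eq_C_mul, C_mul, C_add, map_natCast,
          Nat.add_sub_cancel]
        push_cast
        ring
    rw [h2, Submodule.add_mem_iff_right _ hp] at h1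
    exact (Submodule.smul_mem_iff _ (mul_ne_zero (add_natCast_ne_zero hl j) hκ)).1 h1
  have key : ∀ n (p : MvPolynomial (Fin m) ℂ), (dirDeriv v)^[n] p = 0 →
      ∀ j : ℕ, G ^ j * p ∈ exactPoly G l := by
    intro n
    induction n with
    | zero =>
      intro p hp j
      rw [Function.iterate_zero_apply] at hp
      rw [hp, mul_zero]
      exact Submodule.zero_mem _
    | succ n ih => exact fun p hp j => step p j (ih _ hp _)
  obtain ⟨n, hn⟩ := exists_iterate_dirDeriv_eq_zero v f
  simpa using key n f hn 0

/-- The gradient is `2(A z + b)`, and its pairing with `v` loses the term in `z` since `A` is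
symmetric and `A v = 0`. -/
theorem dirDeriv_quadric {A : Matrix (Fin m) (Fin m) ℂ} (hA : A.IsSymm) (b : Fin m → ℂ) (c : ℂ)
    {v : Fin m → ℂ} (hv : A.mulVec v = 0) :
    dirDeriv v (quadric A b c) = C (2 * b ⬝ᵥ v) := by
  have h1 : ∀ i, ∑ j, C (A i j) * C (v j) = (0 : MvPolynomial (Fin m) ℂ) := by
    intro i
    have := congr_arg (C (σ := Fin m)) (congr_fun hv i)
    simpa [Matrix.mulVec, dotProduct] using this
  have h2 : ∀ j, ∑ i, C (A i j) * C (v i) = (0 : MvPolynomial (Fin m) ℂ) := by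
    intro j
    rw [← h1 j]
    exact Finset.sum_congr rfl fun i _ => by rw [hA.apply]
  have hC : ∀ a : ℂ, dirDeriv v (C a) = 0 := fun a => by simp [dirDeriv]
  have h3 : ∀ i j, dirDeriv v (C (A i j) * X i * X j) =
      X i * (C (A i j) * C (v j)) + X j * (C (A i j) * C (v i)) := by
    intro i j
    rw [Derivation.leibniz, Derivation.leibniz, dirDeriv_X, dirDeriv_X, hC]
    simp only [smul_eq_mul]
    ring
  simp only [quadric, map_add, map_sum, h3, Derivation.leibniz, hC, dirDeriv_X,
    Finset.sum_add_distrib, ← Finset.mul_sum, h1]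
  rw [Finset.sum_comm]
  simp only [← Finset.mul_sum, h2, smul_eq_mul, mul_zero, Finset.sum_const_zero, add_zero,
    zero_add, dotProduct, C_mul, map_sum]

theorem mul_mem_exactPoly_of_det_eq_zero {A : Matrix (Fin m) (Fin m) ℂ} (hA : A.IsSymm)
    (hdet : A.det = 0) (b : Fin m → ℂ) (c : ℂ) {l : ℂ} (hl : ∀ k : ℤ, 2 * l ≠ k)
    (f : MvPolynomial (Fin m) ℂ) :
    f * quadric A b c ∈ exactPoly (quadric A b c) l := by
  obtain ⟨v, hv, hAv⟩ := Matrix.exists_mulVec_eq_zero_iff.2 hdet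
  have hG := dirDeriv_quadric hA b c hAv
  by_cases hb : 2 * b ⬝ᵥ v = 0
  · exact mul_mem_exactPoly_of_dirDeriv_eq_zero hv (by rw [hG, hb, C_0]) l f
  · exact mem_exactPoly_of_dirDeriv_eq_C hb hG hl _

/-! ### Top forms -/

/-- The covariant derivative `∂_i + s (∂_i G) / G` on regular functions. -/
def covDeriv (G : MvPolynomial (Fin m) ℂ) (s : ℂ) (i : Fin m) :
    RegularFunction G →ₗ[ℂ] RegularFunction G :=
  (partialDeriv G i : RegularFunction G →ₗ[ℂ] RegularFunction G) +
    s • LinearMap.mulLeft ℂ (IsLocalization.Away.invSelf G *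
      algebraMap _ (RegularFunction G) (pderiv i G))

theorem covDeriv_apply (G : MvPolynomial (Fin m) ℂ) (s : ℂ) (i : Fin m) (x : RegularFunction G) :
    covDeriv G s i x = partialDeriv G i x + s • (IsLocalization.Away.invSelf G *
      algebraMap _ (RegularFunction G) (pderiv i G) * x) := rfl

/-- The regular function `p / G ^ k`. -/
def divPow (G : MvPolynomial (Fin m) ℂ) (k : ℕ) :
    MvPolynomial (Fin m) ℂ →ₗ[ℂ] RegularFunction G :=
  LinearMap.mulRight ℂ (IsLocalization.Away.invSelf G ^ k : RegularFunction G) ∘ₗ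
    (IsScalarTower.toAlgHom ℂ (MvPolynomial (Fin m) ℂ) (RegularFunction G)).toLinearMap

theorem divPow_apply (G : MvPolynomial (Fin m) ℂ) (k : ℕ) (p : MvPolynomial (Fin m) ℂ) :
    divPow G k p = algebraMap _ (RegularFunction G) p * IsLocalization.Away.invSelf G ^ k := rfl

theorem divPow_mul_pow (G : MvPolynomial (Fin m) ℂ) (k j : ℕ) (p : MvPolynomial (Fin m) ℂ) :
    divPow G (k + j) (p * G ^ j) = divPow G k p := by
  have h := IsLocalization.Away.mul_invSelf (S := RegularFunction G) G
  calc divPow G (k + j) (p * G ^ j) = divPow G k p *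
      (algebraMap _ (RegularFunction G) G * IsLocalization.Away.invSelf G) ^ j := by
        rw [divPow_apply, divPow_apply, map_mul, map_pow, mul_pow, pow_add]
        ring
    _ = divPow G k p := by rw [h, one_pow, mul_one]

theorem divPow_surjective_ge (G : MvPolynomial (Fin m) ℂ) (N : ℕ) (x : RegularFunction G) :
    ∃ k p, N ≤ k ∧ divPow G k p = x := by
  have h := IsLocalization.Away.mul_invSelf (S := RegularFunction G) G
  obtain ⟨n, p, hp⟩ := IsLocalization.Away.surj G x
  refine ⟨n + N, p * G ^ N, Nat.le_add_left _ _, ?_⟩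
  rw [divPow_mul_pow, divPow_apply, ← hp, mul_assoc, ← mul_pow, h, one_pow, mul_one]

theorem divPow_injective {G : MvPolynomial (Fin m) ℂ} (hG : G ≠ 0) (k : ℕ) :
    Function.Injective (divPow G k) := by
  have h := IsLocalization.Away.mul_invSelf (S := RegularFunction G) G
  have hu : IsUnit (IsLocalization.Away.invSelf G : RegularFunction G) :=
    IsUnit.of_mul_eq_one _ (by rw [mul_comm]; exact h)
  intro p q hpq
  rw [divPow_apply, divPow_apply] at hpq
  exact IsLocalization.injective (RegularFunction G)
    (powers_le_nonZeroDivisors_of_noZeroDivisors hG) ((hu.pow k).mul_right_cancel hpq)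

/-- A pole of order `k` shifts the exponent of the twist to `s - k`; this links forms to
`exactPoly`. -/
theorem covDeriv_divPow (G : MvPolynomial (Fin m) ℂ) (s : ℂ) (i : Fin m) (k : ℕ)
    (p : MvPolynomial (Fin m) ℂ) :
    covDeriv G s i (divPow G k p) = divPow G (k + 1) (twistedPderiv G (s - k) i p) := by
  have h := IsLocalization.Away.mul_invSelf (S := RegularFunction G) G
  have hinv := (partialDeriv G i).leibniz_of_mul_eq_one ((mul_comm _ _).trans h)
  rw [partialDeriv_algebraMap] at hinv
  have hpow : partialDeriv G i (IsLocalization.Away.invSelf G ^ k) =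
      -(k : RegularFunction G) * IsLocalization.Away.invSelf G ^ (k + 1) *
        algebraMap _ (RegularFunction G) (pderiv i G) := by
    rw [Derivation.leibniz_pow, hinv]
    rcases k with _ | k
    · simp
    · simp only [nsmul_eq_mul, smul_eq_mul, Nat.add_sub_cancel]
      ring
  rw [covDeriv_apply, divPow_apply, divPow_apply, Derivation.leibniz, hpow,
    partialDeriv_algebraMap, twistedPderiv_apply, map_add, map_mul, Algebra.smul_def s,
    IsScalarTower.algebraMap_apply ℂ (MvPolynomial (Fin m) ℂ), MvPolynomial.algebraMap_eq,
    smul_eq_C_mul, map_mul, map_mul, C_sub, map_sub, map_natCast, map_natCast]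
  simp only [smul_eq_mul]
  linear_combination (-algebraMap _ (RegularFunction G) (pderiv i p) *
    IsLocalization.Away.invSelf G ^ k) * h

theorem derivAlong_single (G : MvPolynomial (Fin m) ℂ) (i : Fin m) (x : RegularFunction G) :
    derivAlong G (Pi.single i 1) x = partialDeriv G i x := by
  simp [derivAlong, Pi.single_apply]

theorem nabla_apply_single {n : ℕ} (G : MvPolynomial (Fin (n + 1)) ℂ) (s : ℂ) (ψ : Form G n) :
    nabla G s n ψ (fun i => Pi.single i 1) = ∑ i : Fin (n + 1), (-1) ^ (i : ℕ) •
      covDeriv G s i (ψ (Fin.removeNth (α := fun _ => Fin (n + 1) → ℂ) i fun j => Pi.single j 1)) := by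
  simp only [nabla, extD, wedgeLeft, LinearMap.add_apply, AlternatingMap.add_apply,
    LinearMap.comp_apply, AlternatingMap.alternatizeUncurryFinLM_apply,
    AlternatingMap.alternatizeUncurryFin_apply, ← Finset.sum_add_distrib, ← smul_add]
  refine Finset.sum_congr rfl fun i _ => ?_
  congr 1
  rw [covDeriv_apply]
  simp [LinearMap.mk₂_apply, derivAlong_single, dlog, partialDeriv_algebraMap]

theorem volumeForm_apply (G : MvPolynomial (Fin m) ℂ) (v : Fin m → Fin m → ℂ) :
    volumeForm G v = algebraMap ℂ (RegularFunction G) (Matrix.det (Matrix.of v)) := rfl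

theorem volumeForm_single (G : MvPolynomial (Fin m) ℂ) :
    volumeForm G (fun i => Pi.single i 1) = 1 := by
  rw [volumeForm_apply]
  have : (Matrix.of fun i : Fin m => Pi.single i (1 : ℂ)) = (1 : Matrix (Fin m) (Fin m) ℂ) := by
    ext i j
    simp [Matrix.one_apply, Pi.single_apply, eq_comm]
  rw [this, Matrix.det_one, map_one]

theorem topForm_ext {G : MvPolynomial (Fin m) ℂ} {φ ψ : Form G m}
    (h : φ (fun i => Pi.single i 1) = ψ (fun i => Pi.single i 1)) : φ = ψ := by
  refine (Pi.basisFun ℂ (Fin m)).ext_alternating fun v hv => ?_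
  obtain ⟨σ, rfl⟩ : ∃ σ : Equiv.Perm (Fin m), v = σ :=
    ⟨Equiv.ofBijective v (Finite.injective_iff_bijective.1 hv), rfl⟩
  have h1 : (fun i => (Pi.basisFun ℂ (Fin m)) (σ i)) =
      (fun i => (Pi.single i 1 : Fin m → ℂ)) ∘ σ := by
    ext1 i
    simp
  rw [h1, AlternatingMap.map_perm, AlternatingMap.map_perm, h]

/-- Top forms are the regular multiples of the volume form. -/
def topFormEquiv (G : MvPolynomial (Fin m) ℂ) : RegularFunction G ≃ₗ[ℂ] Form G m where
  toFun f := f • volumeForm G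
  invFun φ := φ fun i => Pi.single i 1
  map_add' f g := add_smul f g _
  map_smul' a f := AlternatingMap.ext fun v => smul_mul_assoc a f _
  left_inv f := by
    change (f • volumeForm G) (fun i => Pi.single i 1) = f
    rw [AlternatingMap.smul_apply, volumeForm_single, smul_eq_mul, mul_one]
  right_inv φ := topForm_ext (by
    rw [AlternatingMap.smul_apply, volumeForm_single, smul_eq_mul, mul_one])

theorem topFormEquiv_apply (G : MvPolynomial (Fin m) ℂ) (f : RegularFunction G) :
    topFormEquiv G f = f • volumeForm G := rfl

theorem topFormEquiv_symm_apply (G : MvPolynomial (Fin m) ℂ) (φ : Form G m) :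
    (topFormEquiv G).symm φ = φ fun i => Pi.single i 1 := rfl

/-- The regular functions that are coefficients of exact top forms. -/
def exactFunctions (G : MvPolynomial (Fin m) ℂ) (s : ℂ) : Submodule ℂ (RegularFunction G) :=
  ⨆ i, LinearMap.range (covDeriv G s i)

theorem covDeriv_mem_exactFunctions (G : MvPolynomial (Fin m) ℂ) (s : ℂ) (i : Fin m)
    (x : RegularFunction G) : covDeriv G s i x ∈ exactFunctions G s :=
  Submodule.mem_iSup_of_mem i ⟨x, rfl⟩

theorem topFormEquiv_mem_exactForms (G : MvPolynomial (Fin m) ℂ) (s : ℂ)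
    (f : RegularFunction G) :
    topFormEquiv G f ∈ exactForms G s m ↔ f ∈ exactFunctions G s := by
  -- In dimension zero both sides say `f = 0`: there are no exact forms and no derivatives.
  rcases m with _ | n
  · rw [exactForms, exactFunctions, iSup_of_empty, Submodule.mem_bot, Submodule.mem_bot,
      LinearEquiv.map_eq_zero_iff]
  constructor
  · rintro ⟨ψ, hψ⟩
    have h1 := nabla_apply_single G s ψ
    rw [hψ, ← topFormEquiv_symm_apply, LinearEquiv.symm_apply_apply] at h1
    rw [h1]
    refine Submodule.sum_mem _ fun i _ => ?_
    exact zsmul_mem (S := Submodule ℂ (RegularFunction G))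
      (covDeriv_mem_exactFunctions G s i _) ((-1) ^ (i : ℕ))
  · intro hf
    refine (iSup_le fun i => ?_ : exactFunctions G s ≤
      (exactForms G s (n + 1)).comap (topFormEquiv G).toLinearMap) hf
    rintro _ ⟨x, rfl⟩
    -- The contraction of `x dz₁ ∧ … ∧ dz_m` with `e_i`. Only the `i`-th term of `∇` survives on the
    -- standard frame, since every other one evaluates the volume form on a repeated `e_i`; the two
    -- signs cancel.
    refine ⟨x • (volumeForm G).curryLeft (Pi.single i 1), (topFormEquiv G).symm.injective ?_⟩
    rw [LinearEquiv.coe_coe, LinearEquiv.symm_apply_apply, topFormEquiv_symm_apply,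
      nabla_apply_single, Finset.sum_eq_single i]
    · have h1 := Fin.insertNth_self_removeNth (α := fun _ => Fin (n + 1) → ℂ) i
        (fun k => Pi.single k 1)
      rw [AlternatingMap.smul_apply, AlternatingMap.curryLeft_apply_apply,
        ← AlternatingMap.neg_one_pow_smul_map_insertNth _ i, h1, volumeForm_single,
        smul_comm x, map_zsmul, smul_smul, ← mul_pow]
      simp
    · intro j _ hji
      have h0 : volumeForm G (j.insertNth (Pi.single i 1)
          (Fin.removeNth (α := fun _ => Fin (n + 1) → ℂ) j fun k => Pi.single k 1)) = 0 := by
        refine (volumeForm G).map_eq_zero_of_eq _ (i := i) (j := j) ?_ (Ne.symm hji)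
        obtain ⟨k, rfl⟩ := Fin.exists_succAbove_eq (Ne.symm hji)
        rw [Fin.insertNth_apply_same, Fin.insertNth_apply_succAbove, Fin.removeNth]
      rw [AlternatingMap.smul_apply, AlternatingMap.curryLeft_apply_apply,
        ← AlternatingMap.neg_one_pow_smul_map_insertNth _ j, h0, smul_zero, smul_zero, map_zero,
        smul_zero]
    · exact fun h => absurd (Finset.mem_univ i) h

theorem divPow_mem_exactFunctions {G : MvPolynomial (Fin m) ℂ} {s : ℂ} {k : ℕ}
    {p : MvPolynomial (Fin m) ℂ} (hp : p ∈ exactPoly G (s - k)) :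
    divPow G (k + 1) p ∈ exactFunctions G s := by
  refine exactPoly_le (S := (exactFunctions G s).comap (divPow G (k + 1))) (fun i q => ?_) hp
  rw [Submodule.mem_comap, ← covDeriv_divPow]
  exact covDeriv_mem_exactFunctions _ _ _ _

/-- Both sides describe the same derivative, as `q G ^ l = (q G) G ^ (l - 1)`. -/
theorem mul_mem_exactPoly {G : MvPolynomial (Fin m) ℂ} {l : ℂ} {p : MvPolynomial (Fin m) ℂ}
    (hp : p ∈ exactPoly G l) : p * G ∈ exactPoly G (l - 1) := by
  refine exactPoly_le (S := (exactPoly G (l - 1)).comap (LinearMap.mulRight ℂ G))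
    (fun i q => ?_) hp
  have : twistedPderiv G l i q * G = twistedPderiv G (l - 1) i (q * G) := by
    rw [twistedPderiv_apply, twistedPderiv_apply, pderiv_mul, smul_eq_C_mul, smul_eq_C_mul,
      C_sub, C_1]
    ring
  rw [Submodule.mem_comap, LinearMap.mulRight_apply, this]
  exact twistedPderiv_mem_exactPoly _ _ _ _

theorem mul_pow_mem_exactPoly {G : MvPolynomial (Fin m) ℂ} {l : ℂ} {p : MvPolynomial (Fin m) ℂ}
    (hp : p ∈ exactPoly G l) (j : ℕ) : p * G ^ j ∈ exactPoly G (l - j) := by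
  induction j with
  | zero => simpa using hp
  | succ j ih =>
    have := mul_mem_exactPoly ih
    rwa [mul_assoc, ← pow_succ, sub_sub, ← Nat.cast_succ] at this

/-- Summands with different pole orders are brought to a common denominator. The bound `N` leaves
room to compare with `1 / G ^ N`. -/
theorem exists_exactPoly_of_mem_exactFunctions {G : MvPolynomial (Fin m) ℂ} {s : ℂ} (N : ℕ)
    {x : RegularFunction G} (hx : x ∈ exactFunctions G s) :
    ∃ k, N ≤ k ∧ ∃ p ∈ exactPoly G (s - k), divPow G (k + 1) p = x := by
  induction hx using Submodule.iSup_induction' with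
  | mem i x hx =>
    obtain ⟨y, rfl⟩ := hx
    obtain ⟨k, p, hk, rfl⟩ := divPow_surjective_ge G N y
    exact ⟨k, hk, _, twistedPderiv_mem_exactPoly _ _ _ _, (covDeriv_divPow G s i k p).symm⟩
  | zero => exact ⟨N, le_rfl, 0, Submodule.zero_mem _, map_zero _⟩
  | add x y _ _ hx hy =>
    obtain ⟨k, hk, p, hp, rfl⟩ := hx
    obtain ⟨j, hj, q, hq, rfl⟩ := hy
    refine ⟨k + j, hk.trans (Nat.le_add_right _ _), p * G ^ j + q * G ^ k,
      Submodule.add_mem _ ?_ ?_, ?_⟩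
    · have := mul_pow_mem_exactPoly hp j
      rwa [sub_sub, ← Nat.cast_add] at this
    · have := mul_pow_mem_exactPoly hq k
      rwa [sub_sub, ← Nat.cast_add, add_comm j k] at this
    · rw [map_add, show k + j + 1 = k + 1 + j by omega, divPow_mul_pow,
        show k + 1 + j = j + 1 + k by omega, divPow_mul_pow]

/-! ### Top cohomology -/

theorem nabla_topForm (G : MvPolynomial (Fin m) ℂ) (s : ℂ) (φ : Form G m) :
    nabla G s m φ = 0 := by
  refine (Pi.basisFun ℂ (Fin m)).ext_alternating fun v hv => ?_
  exact absurd (Fintype.card_le_of_injective v hv) (by simp)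

theorem exactFunctions_eq_top {G : MvPolynomial (Fin m) ℂ} {s : ℂ}
    (h : ∀ (k : ℕ) p, p * G ∈ exactPoly G (s - k)) : exactFunctions G s = ⊤ := by
  refine eq_top_iff.2 fun x _ => ?_
  obtain ⟨k, p, -, rfl⟩ := divPow_surjective_ge G 0 x
  -- Derivatives of `q / G ^ k` have denominator `G ^ (k + 1)`, so `p / G ^ k` is read as `p G / G ^
  -- (k + 1)`; hence only multiples of `G` matter.
  rw [← divPow_mul_pow G k 1, pow_one]
  exact divPow_mem_exactFunctions (h k p)

theorem exactFunctions_sup_span {G : MvPolynomial (Fin m) ℂ} {s : ℂ} (N : ℕ)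
    (h : ∀ k j : ℕ, exactPoly G (s - k) ⊔ Submodule.span ℂ {G ^ j} = ⊤) :
    exactFunctions G s ⊔ Submodule.span ℂ {divPow G N 1} = ⊤ := by
  refine eq_top_iff.2 fun x _ => ?_
  obtain ⟨k, p, hk, rfl⟩ := divPow_surjective_ge G N x
  obtain ⟨j, rfl⟩ := Nat.exists_eq_add_of_le hk
  have hp : p * G ∈ (⊤ : Submodule ℂ (MvPolynomial (Fin m) ℂ)) := trivial
  rw [← h (N + j) (j + 1), Submodule.mem_sup] at hp
  obtain ⟨y, hy, z, hz, hyz⟩ := hp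
  obtain ⟨a, rfl⟩ := Submodule.mem_span_singleton.1 hz
  rw [← divPow_mul_pow G (N + j) 1, pow_one, ← hyz, map_add, map_smul, ← one_mul (G ^ (j + 1)),
    add_assoc N j 1, divPow_mul_pow, ← add_assoc]
  exact Submodule.add_mem_sup (divPow_mem_exactFunctions hy)
    (Submodule.smul_mem _ _ (Submodule.mem_span_singleton_self _))

theorem divPow_one_notMem_exactFunctions {G : MvPolynomial (Fin m) ℂ} {s : ℂ} (N : ℕ)
    (h : ∀ k j : ℕ, G ^ j ∉ exactPoly G (s - k)) : divPow G N 1 ∉ exactFunctions G s := by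
  intro hx
  -- Needed to compare numerators: over `G = 0` the localization is trivial.
  have hG : G ≠ 0 := by
    rintro rfl
    exact h 0 1 (by rw [pow_one]; exact Submodule.zero_mem _)
  obtain ⟨k, hk, p, hp, hpx⟩ := exists_exactPoly_of_mem_exactFunctions N hx
  obtain ⟨j, rfl⟩ := Nat.exists_eq_add_of_le hk
  rw [← divPow_mul_pow G N (j + 1), one_mul, ← add_assoc] at hpx
  rw [divPow_injective hG _ hpx] at hp
  exact h _ _ hp

theorem cohomologyClass_eq_zero_iff (G : MvPolynomial (Fin m) ℂ) (s : ℂ) (f : RegularFunction G) :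
    cohomologyClass G s m (topFormEquiv G f) (nabla_topForm G s _) = 0 ↔
      f ∈ exactFunctions G s := by
  rw [cohomologyClass, Submodule.Quotient.mk_eq_zero, Submodule.submoduleOf,
    Submodule.mem_comap, Submodule.subtype_apply, topFormEquiv_mem_exactForms]

theorem rank_cohomology_eq_zero {G : MvPolynomial (Fin m) ℂ} {s : ℂ}
    (h : exactFunctions G s = ⊤) : Module.rank ℂ (Cohomology G s m) = 0 := by
  have : Subsingleton (Cohomology G s m) := by
    refine subsingleton_of_forall_eq 0 fun x => ?_
    obtain ⟨⟨φ, hφ⟩, rfl⟩ := Submodule.Quotient.mk_surjective _ x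
    obtain ⟨f, rfl⟩ := (topFormEquiv G).surjective φ
    exact (cohomologyClass_eq_zero_iff G s f).2 (h ▸ trivial)
  exact rank_subsingleton' ℂ _

theorem span_cohomologyClass {G : MvPolynomial (Fin m) ℂ} {s : ℂ} {f : RegularFunction G}
    (h : exactFunctions G s ⊔ Submodule.span ℂ {f} = ⊤) :
    Submodule.span ℂ {cohomologyClass G s m (topFormEquiv G f) (nabla_topForm G s _)} = ⊤ := by
  refine eq_top_iff.2 fun x _ => ?_
  obtain ⟨⟨φ, hφ⟩, rfl⟩ := Submodule.Quotient.mk_surjective _ x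
  obtain ⟨g, rfl⟩ := (topFormEquiv G).surjective φ
  have hg : g ∈ exactFunctions G s ⊔ Submodule.span ℂ {f} := h ▸ trivial
  obtain ⟨y, hy, z, hz, rfl⟩ := Submodule.mem_sup.1 hg
  obtain ⟨a, rfl⟩ := Submodule.mem_span_singleton.1 hz
  refine Submodule.mem_span_singleton.2 ⟨a, ?_⟩
  rw [cohomologyClass, ← Submodule.Quotient.mk_smul, eq_comm, Submodule.Quotient.eq,
    Submodule.submoduleOf, Submodule.mem_comap]
  have : topFormEquiv G (y + a • f) - a • topFormEquiv G f = topFormEquiv G y := by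
    rw [map_add, map_smul, add_sub_cancel_right]
  change topFormEquiv G (y + a • f) - a • topFormEquiv G f ∈ exactForms G s m
  rwa [this, topFormEquiv_mem_exactForms]

theorem rank_eq_one_of_span_singleton_eq_top {V : Type*} [AddCommGroup V] [Module ℂ V] {v : V}
    (hv : v ≠ 0) (h : Submodule.span ℂ {v} = ⊤) : Module.rank ℂ V = 1 :=
  rank_eq_one v hv fun _ => Submodule.mem_span_singleton.1 (h ▸ Submodule.mem_top)

theorem sphereForm_eq (G : MvPolynomial (Fin m) ℂ) :
    sphereForm G = topFormEquiv G (divPow G ((m + 1) / 2) 1) := by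
  rw [topFormEquiv_apply, divPow_apply, map_one, one_mul, sphereForm]

/-- The scalar `a` serves both the plain form (`a = 1`) and the normalized `dOmega`. -/
theorem cohomology_of_smul_sphereForm {G : MvPolynomial (Fin m) ℂ} {ρ s a : ℂ}
    (hG : AffineEquivalent G (diagQuadric m ρ)) (hρ : ρ ≠ 0)
    (hs : ∀ k : ℤ, 2 * s ≠ k) (ha : a ≠ 0) :
    Module.rank ℂ (Cohomology G s m) = 1 ∧
      ∃ h : nabla G s m (a • sphereForm G) = 0,
        Submodule.span ℂ {cohomologyClass G s m (a • sphereForm G) h} = ⊤ := by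
  have hsk : ∀ (k : ℕ) (n : ℤ), 2 * (s - k) ≠ n := fun k n h =>
    hs (n + 2 * k) (by push_cast; linear_combination h)
  have hspan := span_cohomologyClass (f := a • divPow G ((m + 1) / 2) 1)
    (by
      rw [Submodule.span_singleton_smul_eq ha.isUnit]
      exact exactFunctions_sup_span _ fun k j =>
        exactPoly_sup_span_pow_of_affineEquivalent hG (hsk k) hρ j)
  have hne := mt (cohomologyClass_eq_zero_iff G s (a • divPow G ((m + 1) / 2) 1)).1
    (mt (Submodule.smul_mem_iff _ ha).1 (divPow_one_notMem_exactFunctions _ fun k j =>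
      pow_notMem_exactPoly_of_affineEquivalent hG (hsk k) hρ j))
  refine ⟨rank_eq_one_of_span_singleton_eq_top hne hspan, nabla_topForm _ _ _, ?_⟩
  simp only [sphereForm_eq, ← (topFormEquiv G).map_smul]
  exact hspan

theorem rank_cohomology_cone {G : MvPolynomial (Fin m) ℂ} {s : ℂ}
    (hG : AffineEquivalent G (diagQuadric m 0)) (hs : ∀ k : ℤ, 2 * s ≠ k) :
    Module.rank ℂ (Cohomology G s m) = 0 :=
  rank_cohomology_eq_zero (exactFunctions_eq_top fun k p =>
    mul_mem_exactPoly_of_affineEquivalent hG (fun n h =>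
      hs (n + 2 * k) (by push_cast; linear_combination h)) p)

theorem rank_cohomology_of_det_eq_zero {A : Matrix (Fin m) (Fin m) ℂ} (hA : A.IsSymm)
    (hdet : A.det = 0) (b : Fin m → ℂ) (c : ℂ) {s : ℂ} (hs : ∀ k : ℤ, 2 * s ≠ k) :
    Module.rank ℂ (Cohomology (quadric A b c) s m) = 0 :=
  rank_cohomology_eq_zero (exactFunctions_eq_top fun k p =>
    mul_mem_exactPoly_of_det_eq_zero hA hdet b c (fun n h =>
      hs (n + 2 * k) (by push_cast; linear_combination h)) p)

theorem affineEquivalent_refl (G : MvPolynomial (Fin m) ℂ) : AffineEquivalent G G :=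
  ⟨1, 1, 0, one_mul 1, MvPolynomial.funext fun x => by
    rw [eval_affineSubst, Matrix.one_mulVec, add_zero]⟩

theorem sphereConstant_ne_zero (m : ℕ) {ε : ℂ} (hε : ∀ k : ℤ, 2 * ε ≠ k) :
    sphereConstant m ε ≠ 0 := by
  refine mul_ne_zero (pow_ne_zero _ (by simpa using hε 0)) ?_
  rw [Ne, ascPochhammer_eval_eq_zero_iff]
  rintro ⟨k, -, hk⟩
  -- A zero of the rising factorial would make `ε` a natural number.
  exact hε (2 * k) (by push_cast; linear_combination -2 * hk)

end TwistedDeRham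

end

theorem mainTheorem1 (m : ℕ) (ε s : ℂ) (hε : ∀ k : ℤ, 2 * ε ≠ (k : ℂ))
    (hs : s = ε ∨ s = -ε) :
    (∀ (A : Matrix (Fin m) (Fin m) ℂ) (b : Fin m → ℂ) (c : ℂ), A.IsSymm →
      ((TwistedDeRham.radiusSq A b c ≠ ((0 : ℂ) : OnePoint ℂ) ∧
          TwistedDeRham.radiusSq A b c ≠ OnePoint.infty →
        Module.rank ℂ (TwistedDeRham.Cohomology (TwistedDeRham.quadric A b c) s m) = 1 ∧
        ∃ h : TwistedDeRham.nabla (TwistedDeRham.quadric A b c) s m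
            (TwistedDeRham.sphereForm (TwistedDeRham.quadric A b c)) = 0,
          Submodule.span ℂ {TwistedDeRham.cohomologyClass (TwistedDeRham.quadric A b c) s m
            (TwistedDeRham.sphereForm (TwistedDeRham.quadric A b c)) h} = ⊤) ∧
      (TwistedDeRham.radiusSq A b c = ((0 : ℂ) : OnePoint ℂ) ∨
          TwistedDeRham.radiusSq A b c = OnePoint.infty →
        Module.rank ℂ (TwistedDeRham.Cohomology (TwistedDeRham.quadric A b c) s m) = 0))) ∧
    (∀ r : ℂ,
      (r ≠ 0 →
        Module.rank ℂ (TwistedDeRham.Cohomology (TwistedDeRham.roundQuadric m r) s m) = 1 ∧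
        ∃ h : TwistedDeRham.nabla (TwistedDeRham.roundQuadric m r) s m
            (TwistedDeRham.dOmega m r ε) = 0,
          Submodule.span ℂ {TwistedDeRham.cohomologyClass (TwistedDeRham.roundQuadric m r) s m
            (TwistedDeRham.dOmega m r ε) h} = ⊤) ∧
      (r = 0 →
        Module.rank ℂ (TwistedDeRham.Cohomology (TwistedDeRham.roundQuadric m r) s m) = 0)) := by
  have hs' : ∀ k : ℤ, 2 * s ≠ k := by
    rcases hs with rfl | rfl
    · exact hε
    · exact fun k h => hε (-k) (by push_cast; linear_combination -h)
  refine ⟨fun A b c hA => ⟨?_, ?_⟩, fun r => ⟨fun hr => ?_, ?_⟩⟩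
  · rintro ⟨h0, hinf⟩
    have hdet : A.det ≠ 0 := fun h => hinf (if_pos h)
    rw [TwistedDeRham.radiusSq, if_neg hdet, Ne, OnePoint.coe_eq_coe] at h0
    simpa only [one_smul] using TwistedDeRham.cohomology_of_smul_sphereForm
      (TwistedDeRham.affineEquivalent_diagQuadric hA hdet b c) h0 hs' one_ne_zero
  · intro h
    by_cases hdet : A.det = 0
    · exact TwistedDeRham.rank_cohomology_of_det_eq_zero hA hdet b c hs'
    · rw [TwistedDeRham.radiusSq, if_neg hdet, OnePoint.coe_eq_coe,
        or_iff_left (OnePoint.coe_ne_infty _)] at h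
      have hG := TwistedDeRham.affineEquivalent_diagQuadric hA hdet b c
      rw [h] at hG
      exact TwistedDeRham.rank_cohomology_cone hG hs'
  -- The round quadric is by definition `diagQuadric` with `ρ = r ^ 2`, so no change of variables is
  -- needed.
  · exact TwistedDeRham.cohomology_of_smul_sphereForm (TwistedDeRham.affineEquivalent_refl _)
      (pow_ne_zero 2 hr) hs' (mul_ne_zero (TwistedDeRham.sphereConstant_ne_zero m hε)
        (pow_ne_zero _ hr))
  · rintro rfl
    refine TwistedDeRham.rank_cohomology_cone ?_ hs'
    have : TwistedDeRham.roundQuadric m 0 = TwistedDeRham.diagQuadric m 0 := by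
      rw [TwistedDeRham.roundQuadric, TwistedDeRham.diagQuadric, zero_pow two_ne_zero]
    rw [this]
    exact TwistedDeRham.affineEquivalent_refl _
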